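/- Notation. For $d\in\mathbb N$, $L\ge1$, $p,K\in\mathbb N$, $\kappa,R\ge 0$ let $\mathcal F_{NN}(d,1,L,p,K,\kappa,R)$ be the class of functions $q:\mathbb R^{d}\to\mathbb R$ with $|q|\le R$ of the form $q(x)=W_L\,\mathrm{ReLU}(W_{L-1}\cdots\mathrm{ReLU}(W_1x+b_1)\cdots+b_{L-1})+b_L$ ($L$ layers) whose hidden layers have at most $p$ neurons, whose weights and biases have at most $K$ nonzero entries in total, and all of whose weights and biases are bounded by $\kappa$ in absolute value. Theorem. Let $d_1,d_2,b_U,n_x>0$ be integers and $\gamma_1,\gamma_2,\beta_U,\beta_V,L_U,L_V,L_G,C_A>0$; put $\Omega_U=[-\gamma_1,\gamma_1]^{d_1}$, $\Omega_V=[-\gamma_2,\gamma_2]^{d_2}$. Let $U$ (resp. $V$) be a set of real functions on $\Omega_U$ (resp. $\Omega_V$), each of which is Lipschitz for the Euclidean norm with constant at most $L_U$ (resp. $L_V$) and bounded in absolute value by $\beta_U$ (resp. $\beta_V$). Let $\omega_1,\dots,\omega_{b_U}$ be orthonormal in $L^2(\Omega_U)$ such that every $u\in U$ equals $\sum_{k}\alpha_k\omega_k$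 in $L^2(\Omega_U)$ with $\alpha_k=\alpha_k(u)=\int_{\Omega_U}u\,\omega_k$. Let $x_1,\dots,x_{n_x}\in\Omega_U$, write $\mathbf u=(u(x_1),\dots,u(x_{n_x}))^\top$, and suppose that there is a matrix $A\in\mathbb R^{b_U\times n_x}$ with $\max_{k,j}|A_{kj}|\le C_A$ and $A\mathbf u=(\alpha_1(u),\dots,\alpha_{b_U}(u))^\top$ for all $u\in U$. There is a constant $C>0$ depending only on $d_2,L_V,\gamma_2$ such that the following holds. For any $\varepsilon>0$ set $N=\lceil C\varepsilon^{-d_2}\rceil$. There exist two network architectures, $\mathcal F_1=\mathcal F_{NN}(d_2,1,L_1,p_1,K_1,\kappa_1,1)$ with $$L_1=O(\log(\varepsilon^{-1})),\quad p_1=O(1),\quad K_1=O(\log(\varepsilon^{-1})),\quad \kappa_1=O(\varepsilon^{-1}),$$ and $\mathcal F_2=\mathcal F_{NN}(n_x,1,L_2,p_2,K_2,\kappa_2,\beta_V)$ with $$L_2=O(\log(\varepsilon^{-1})),\quad p_2=O(\varepsilon^{-(d_2+1)b_U}),\quad K_2=O\big(\varepsilon^{-(d_2+1)b_U}(\log(\varepsilon^{-1})+n_x)\big),\quad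 \kappa_2=O(\varepsilon^{-(d_2+1)(b_U+1)}),$$ such that for any operator $G:U\to V$ with $\sup_{y\in\Omega_V}|G(u_1)(y)-G(u_2)(y)|\le L_G\|u_1-u_2\|_{L^2(\Omega_U)}$ for all $u_1,u_2\in U$, there are $\tilde q_1,\dots,\tilde q_N\in\mathcal F_1$ (trunk nets) and $\tilde a_1,\dots,\tilde a_N\in\mathcal F_2$ (branch nets) with $$\sup_{u\in U}\sup_{y\in\Omega_V}\Big|G(u)(y)-\sum_{k=1}^{N}\tilde a_k(\mathbf u)\,\tilde q_k(y)\Big|\le\varepsilon .$$ In particular, the total number of nonzero parameters obeys the power law (up to the logarithm) $N(K_1+K_2)=O\big(\varepsilon^{-((d_2+1)b_U+d_2)}(\log(\varepsilon^{-1})+n_x)\big)$. Here a bound $O(g(\varepsilon))$ means at most $c\,g(\varepsilon)$ for $0<\varepsilon\le\frac12$ and at most $c\,g(\frac12)$ for $\varepsilon>\frac12$, with one constant $c>0$ depending only on $\gamma_1,\gamma_2,\beta_U,\beta_V,d_1,d_2,L_G,L_U,L_V,b_U,C_A$ (not on $n_x$, $U$, $V$, the $\omega_k$, the grid, $A$,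 $G$ or $\varepsilon$). -/

import Mathlib

open MeasureTheory

noncomputable section

namespace DeepONet

/-- The cube `[-γ, γ]^d` inside Euclidean space `ℝ^d` (so that distances are `ℓ²` distances and
`volume` is Lebesgue measure). -/
def cube (d : ℕ) (γ : ℝ) : Set (EuclideanSpace ℝ (Fin d)) :=
  {x | ∀ i, x i ∈ Set.Icc (-γ) γ}

/-- Lebesgue measure on the cube `[-γ, γ]^d`. -/
def cubeMeasure (d : ℕ) (γ : ℝ) : Measure (cube d γ) :=
  (volume : Measure (EuclideanSpace ℝ (Fin d))).comap Subtype.val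

/-- Every function of the set `U` of real functions on `[-γ, γ]^d` is Lipschitz with constant at
most `L` with respect to the Euclidean norm, and is bounded by `β` in the supremum norm. -/
def IsLipschitzBoundedClass {d : ℕ} {γ : ℝ} (L β : ℝ) (U : Set (cube d γ → ℝ)) : Prop :=
  ∀ u ∈ U, (∀ x y : cube d γ, |u x - u y| ≤ L * dist x y) ∧ ∀ x : cube d γ, |u x| ≤ β

/-- The `L²` norm of a function on `[-γ, γ]^d`. -/
def l2norm {d : ℕ} {γ : ℝ} (u : cube d γ → ℝ) : ℝ :=
  Real.sqrt (∫ x, (u x) ^ 2 ∂(cubeMeasure d γ))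

/-- The functions `ω_1, …, ω_b` are orthonormal in `L²([-γ, γ]^d)`. -/
def IsOrthonormalFamily {d b : ℕ} {γ : ℝ} (ω : Fin b → cube d γ → ℝ) : Prop :=
  (∀ k, MemLp (ω k) 2 (cubeMeasure d γ)) ∧
    ∀ j k, ∫ x, ω j x * ω k x ∂(cubeMeasure d γ) = if j = k then 1 else 0

/-- The coefficient `α_k = ∫ u ω_k` of `u` with respect to `ω_k`. -/
def coeff {d b : ℕ} {γ : ℝ} (ω : Fin b → cube d γ → ℝ) (u : cube d γ → ℝ) (k : Fin b) : ℝ :=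
  ∫ x, u x * ω k x ∂(cubeMeasure d γ)

/-- Every `u ∈ U` equals `∑ k, α_k ω_k` (as an element of `L²`, that is, almost everywhere). -/
def LiesInSpan {d b : ℕ} {γ : ℝ} (U : Set (cube d γ → ℝ)) (ω : Fin b → cube d γ → ℝ) : Prop :=
  ∀ u ∈ U, u =ᵐ[cubeMeasure d γ] fun x => ∑ k, coeff ω u k * ω k x

/-- The vector `(u(x_1), …, u(x_n))` of the samples of `u` on a grid. -/
def samples {d n : ℕ} {γ : ℝ} (x : Fin n → cube d γ) (u : cube d γ → ℝ) : Fin n → ℝ :=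
  fun j => u (x j)

/-- The operator `G : U → V` is Lipschitz with constant `LG` from the `L²` norm to the supremum
norm. -/
def IsLipschitzOperator {d₁ d₂ : ℕ} {γ₁ γ₂ : ℝ} (LG : ℝ)
    {U : Set (cube d₁ γ₁ → ℝ)} {V : Set (cube d₂ γ₂ → ℝ)} (G : U → V) : Prop :=
  ∀ u₁ u₂ : U, ∀ y : cube d₂ γ₂,
    |(G u₁ : cube d₂ γ₂ → ℝ) y - (G u₂ : cube d₂ γ₂ → ℝ) y|
      ≤ LG * l2norm ((u₁ : cube d₁ γ₁ → ℝ) - (u₂ : cube d₁ γ₁ → ℝ))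

/-- Real-valued feedforward ReLU networks on `ℝ^d`: the data `(W_1, b_1), …, (W_L, b_L)` of
`x ↦ W_L ReLU(W_{L-1} ⋯ ReLU(W_1 x + b_1) ⋯ + b_{L-1}) + b_L`, listed from the first layer on. -/
inductive ReLUNet : ℕ → Type
  /-- The last layer `x ↦ W_L x + b_L`, with scalar output. -/
  | output {d : ℕ} (W : Matrix (Fin 1) (Fin d) ℝ) (b : Fin 1 → ℝ) : ReLUNet d
  /-- A hidden layer `x ↦ ReLU(W x + b)` with `m` neurons, followed by the rest of the network. -/
  | hidden {d : ℕ} (m : ℕ) (W : Matrix (Fin m) (Fin d) ℝ) (b : Fin m → ℝ) (rest : ReLUNet m) :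
      ReLUNet d

namespace ReLUNet

/-- The function that a network realizes. -/
def eval : {d : ℕ} → ReLUNet d → (Fin d → ℝ) → ℝ
  | _, output W b, x => (W.mulVec x + b) 0
  | _, hidden _ W b rest, x => rest.eval fun i => max ((W.mulVec x + b) i) 0

/-- The number `L` of layers. -/
def depth : {d : ℕ} → ReLUNet d → ℕ
  | _, output _ _ => 1
  | _, hidden _ _ _ rest => rest.depth + 1

/-- The width: the largest number of neurons in a hidden layer. -/
def width : {d : ℕ} → ReLUNet d → ℕ
  | _, output _ _ => 0
  | _, hidden m _ _ rest => max m rest.width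

/-- The number of nonzero weights and biases in one layer. -/
def layerNonzeros {m d : ℕ} (W : Matrix (Fin m) (Fin d) ℝ) (b : Fin m → ℝ) : ℕ :=
  (Finset.univ.filter fun ij : Fin m × Fin d => W ij.1 ij.2 ≠ 0).card
    + (Finset.univ.filter fun i : Fin m => b i ≠ 0).card

/-- The number `∑_l ‖W_l‖₀ + ‖b_l‖₀` of nonzero parameters. -/
def nonzeros : {d : ℕ} → ReLUNet d → ℕ
  | _, output W b => layerNonzeros W b
  | _, hidden _ W b rest => layerNonzeros W b + rest.nonzeros

/-- All weights and biases are bounded by `κ` in absolute value. -/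
def ParamsBounded (κ : ℝ) : {d : ℕ} → ReLUNet d → Prop
  | _, output W b => (∀ i j, |W i j| ≤ κ) ∧ ∀ i, |b i| ≤ κ
  | _, hidden _ W b rest =>
      ((∀ i j, |W i j| ≤ κ) ∧ ∀ i, |b i| ≤ κ) ∧ rest.ParamsBounded κ

end ReLUNet

/-- The network class `F_NN(d, 1, L, p, K, κ, R)`: functions on `ℝ^d` that are realized by a ReLU
network with `L` layers, width at most `p`, at most `K` nonzero parameters, all parameters bounded
by `κ`, and output bounded by `R`. -/
def networkClass (d L p K : ℕ) (κ R : ℝ) : Set ((Fin d → ℝ) → ℝ) :=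
  {q | (∃ φ : ReLUNet d, φ.eval = q ∧ φ.depth = L ∧ φ.width ≤ p ∧ φ.nonzeros ≤ K ∧
      φ.ParamsBounded κ) ∧ ∀ x, |q x| ≤ R}

end DeepONet

end

noncomputable section

namespace DeepONet

/-! The proof interpolates twice by piecewise linear functions on a Kuhn triangulation, whose nodal
functions are exactly ReLU networks. The nodal function at an integer vector `k` is the length of
the set of shifts `t ∈ [0,1)` with `⌊x i + t⌋ = k i` for all `i`. These sets are disjoint and,
inside the grid, cover `[0,1)`. So the nodal functions are nonnegative, sum to at most one
everywhere, and sum to one on the grid cube (`sum_nodal_le_one`, `sum_nodal_eq_one`). They involve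
only finitely many maxima, so a network of fixed size realizes each of them, and only the first
layer sees the mesh (`exists_hat`).

By Parseval, `G u` is a Lipschitz function of the coefficient vector `A.mulVec (samples x u)`, which
lies in a cube of fixed side (`abs_coeff_le`, `l2norm_sub_le`). Interpolating `G u` in `y` with mesh
of order `ε`, and each resulting value `G u (s k)` in the coefficients, gives `∑ k, (∑ j, c k j *
hat j) * hat k`: the outer hats are the trunk nets, the inner sums the branch nets
(`exists_representation`). Convexity keeps both the errors and the outputs bounded.

The depth is constant, so the logarithms only absorb constants. A branch net has width of order `ε⁻¹
^ bU`, and even a dense parameter count, quadratic in the width, fits the exponent `(d₂ + 1) * bU`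
because `d₂ ≥ 1`. -/

theorem sum_extend_mul {α β : Type*} [Fintype α] [Fintype β] {σ : α → β}
    (hσ : Function.Injective σ) (w : α → ℝ) (x : β → ℝ) :
    ∑ l, Function.extend σ w 0 l * x l = ∑ l, w l * x (σ l) := by
  classical
  have h : ∑ l ∈ Finset.univ.image σ, Function.extend σ w 0 l * x l = ∑ l, w l * x (σ l) := by
    rw [Finset.sum_image fun a _ b _ hab => hσ hab]
    exact Finset.sum_congr rfl fun l _ => by rw [hσ.extend_apply]
  rw [← h]
  refine (Finset.sum_subset (Finset.subset_univ _) fun l _ hl => ?_).symm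
  rw [Function.extend_apply' _ _ _ fun ⟨a, ha⟩ => hl (Finset.mem_image.2 ⟨a, Finset.mem_univ _, ha⟩)]
  simp

theorem abs_extend_le {α β : Type*} {σ : α → β} (hσ : Function.Injective σ) {w : α → ℝ} {κ : ℝ}
    (hκ : 0 ≤ κ) (hw : ∀ l, |w l| ≤ κ) (l : β) : |Function.extend σ w 0 l| ≤ κ := by
  by_cases h : ∃ a, σ a = l
  · obtain ⟨a, rfl⟩ := h
    rw [hσ.extend_apply]
    exact hw a
  · rw [Function.extend_apply' _ _ _ h]
    simpa using hκ

/-! ### The nodal function of the Kuhn triangulation -/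

/-- The piecewise linear nodal basis function at the origin of the Kuhn triangulation of `ℝ^b`. -/
def nodal {b : ℕ} (z : Fin b → ℝ) : ℝ :=
  max (1 - Finset.univ.fold max 0 z - Finset.univ.fold max 0 (fun i => -z i)) 0

theorem nodal_nonneg {b : ℕ} (z : Fin b → ℝ) : 0 ≤ nodal z := le_max_right _ _

theorem abs_lt_one_of_nodal_ne_zero {b : ℕ} {z : Fin b → ℝ} (h : nodal z ≠ 0) (i : Fin b) :
    |z i| < 1 := by
  unfold nodal at h
  have h1 : 0 < 1 - Finset.univ.fold max 0 z - Finset.univ.fold max 0 (fun i => -z i) := by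
    by_contra hle
    exact h (max_eq_right (not_lt.1 hle))
  have hp := (Finset.fold_max_le (s := Finset.univ) (f := z) (b := 0) _).1 le_rfl
  have hq := (Finset.fold_max_le (s := Finset.univ) (f := fun i => -z i) (b := 0) _).1 le_rfl
  have := hp.2 i (Finset.mem_univ _)
  have := hq.2 i (Finset.mem_univ _)
  rw [abs_lt]
  constructor <;> linarith [hp.1, hq.1]

/-- The shifts `t` that round `x` to `k`, where `z = k - x`. -/
def shiftSet {b : ℕ} (z : Fin b → ℝ) : Set ℝ :=
  Set.Ico (Finset.univ.fold max 0 z) (1 - Finset.univ.fold max 0 (fun i => -z i))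

/-- With `z = k - x` the last condition reads `k i ≤ x i + t < k i + 1`, that is, `⌊x i + t⌋ = k i`.
-/
theorem mem_shiftSet {b : ℕ} {z : Fin b → ℝ} {t : ℝ} :
    t ∈ shiftSet z ↔ (0 ≤ t ∧ t < 1) ∧ ∀ i, z i ≤ t ∧ t < 1 + z i := by
  have h2 : t < 1 - Finset.univ.fold max 0 (fun i => -z i) ↔
      Finset.univ.fold max 0 (fun i => -z i) < 1 - t := by
    constructor <;> intro h <;> linarith
  rw [shiftSet, Set.mem_Ico, Finset.fold_max_le, h2, Finset.fold_max_lt]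
  constructor
  · rintro ⟨⟨h0, hz⟩, h1, hz'⟩
    refine ⟨⟨h0, by linarith⟩, fun i => ⟨hz i (Finset.mem_univ _), ?_⟩⟩
    linarith [hz' i (Finset.mem_univ _)]
  · rintro ⟨⟨h0, h1⟩, hz⟩
    refine ⟨⟨h0, fun i _ => (hz i).1⟩, by linarith, fun i _ => ?_⟩
    linarith [(hz i).2]

theorem volume_shiftSet {b : ℕ} (z : Fin b → ℝ) : volume.real (shiftSet z) = nodal z := by
  rw [Measure.real, shiftSet, Real.volume_Ico, ENNReal.toReal_ofReal', nodal]
  congr 1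
  ring

/-- A shift `t` determines `k` as the floor of `x + t`, so the shift sets of different `k` are
disjoint and their lengths add up. -/
theorem sum_nodal_eq_volume {b M : ℕ} (x : Fin b → ℝ) :
    ∑ k : Fin b → Fin M, nodal (fun i => ((k i : ℕ) : ℝ) - x i) =
      volume.real (⋃ k ∈ (Finset.univ : Finset (Fin b → Fin M)),
        shiftSet fun i => ((k i : ℕ) : ℝ) - x i) := by
  rw [measureReal_biUnion_finset (h := fun k _ => by
    rw [shiftSet, Real.volume_Ico]; exact ENNReal.ofReal_ne_top)]
  · exact Finset.sum_congr rfl fun k _ => (volume_shiftSet _).symm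
  · intro k _ k' _ hkk'
    refine Set.disjoint_left.2 fun t ht ht' => hkk' ?_
    rw [mem_shiftSet] at ht ht'
    funext i
    have h1 := ht.2 i
    have h2 := ht'.2 i
    have h3 : ((k i : ℕ) : ℝ) < (k' i : ℕ) + 1 := by linarith [h1.1, h2.2]
    have h4 : ((k' i : ℕ) : ℝ) < (k i : ℕ) + 1 := by linarith [h2.1, h1.2]
    have h3' : (k i : ℕ) < (k' i : ℕ) + 1 := by exact_mod_cast h3
    have h4' : (k' i : ℕ) < (k i : ℕ) + 1 := by exact_mod_cast h4
    exact Fin.ext (by omega)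
  · exact fun k _ => measurableSet_Ico

/-- No condition on `x` is needed, which is what bounds the network outputs on the whole space. -/
theorem sum_nodal_le_one {b M : ℕ} (x : Fin b → ℝ) :
    ∑ k : Fin b → Fin M, nodal (fun i => ((k i : ℕ) : ℝ) - x i) ≤ 1 := by
  rw [sum_nodal_eq_volume]
  have h : volume.real (Set.Ico (0 : ℝ) 1) = 1 := by simp [Measure.real]
  rw [← h]
  refine measureReal_mono (Set.iUnion₂_subset fun k _ t ht => ?_) (by simp)
  exact (mem_shiftSet.1 ht).1

theorem sum_nodal_eq_one {b M : ℕ} (x : Fin b → ℝ) (h0 : ∀ i, 0 ≤ x i)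
    (h1 : ∀ i, x i ≤ M - 1) :
    ∑ k : Fin b → Fin M, nodal (fun i => ((k i : ℕ) : ℝ) - x i) = 1 := by
  refine le_antisymm (sum_nodal_le_one x) ?_
  rw [sum_nodal_eq_volume]
  have h : volume.real (Set.Ico (0 : ℝ) 1) = 1 := by simp [Measure.real]
  rw [← h]
  refine measureReal_mono (fun t ht => ?_) ?_
  -- Since `t < 1`, the bound `x i ≤ M - 1` is just enough to keep the floor among the `M` nodes.
  · have hlt : ∀ i, ⌊x i + t⌋₊ < M := fun i => by
      rw [Nat.floor_lt (add_nonneg (h0 i) ht.1)]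
      linarith [h1 i, ht.2]
    refine Set.mem_iUnion₂.2 ⟨fun i => ⟨⌊x i + t⌋₊, hlt i⟩, Finset.mem_univ _, ?_⟩
    refine mem_shiftSet.2 ⟨ht, fun i => ?_⟩
    have h2 := Nat.floor_le (add_nonneg (h0 i) ht.1)
    have h3 := Nat.lt_floor_add_one (x i + t)
    constructor <;> simp only <;> linarith
  · refine ne_top_of_le_ne_top ?_ (measure_mono (t := Set.Ico (0 : ℝ) 1)
      (Set.iUnion₂_subset fun k _ t ht => (mem_shiftSet.1 ht).1))
    simp

/-- The nodal basis functions of the Kuhn triangulation of `[-R, R]^b` with `M` nodes in each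
direction. -/
def hat {b M : ℕ} (R : ℝ) (k : Fin b → Fin M) (y : Fin b → ℝ) : ℝ :=
  nodal fun i => ((k i : ℕ) : ℝ) - (M - 1) / (2 * R) * (y i + R)

theorem hat_nonneg {b M : ℕ} (R : ℝ) (k : Fin b → Fin M) (y : Fin b → ℝ) : 0 ≤ hat R k y :=
  nodal_nonneg _

theorem sum_hat_le_one {b M : ℕ} (R : ℝ) (y : Fin b → ℝ) :
    ∑ k : Fin b → Fin M, hat R k y ≤ 1 := sum_nodal_le_one _

theorem hat_le_one {b M : ℕ} (R : ℝ) (k : Fin b → Fin M) (y : Fin b → ℝ) : hat R k y ≤ 1 :=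
  (Finset.single_le_sum (f := fun k : Fin b → Fin M => hat R k y) (fun k _ => hat_nonneg R k y)
    (Finset.mem_univ k)).trans (sum_hat_le_one R y)

theorem sum_hat_eq_one {b M : ℕ} {R : ℝ} (hR : 0 < R) (hM : 1 ≤ M) {y : Fin b → ℝ}
    (hy : ∀ i, |y i| ≤ R) : ∑ k : Fin b → Fin M, hat R k y = 1 := by
  have hM' : (0 : ℝ) ≤ (M : ℝ) - 1 := by
    have : (1 : ℝ) ≤ M := by exact_mod_cast hM
    linarith
  refine sum_nodal_eq_one _ (fun i => ?_) fun i => ?_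
  · have := (abs_le.1 (hy i)).1
    exact mul_nonneg (by positivity) (by linarith)
  · have := (abs_le.1 (hy i)).2
    calc ((M : ℝ) - 1) / (2 * R) * (y i + R) ≤ (M - 1) / (2 * R) * (2 * R) :=
          mul_le_mul_of_nonneg_left (by linarith) (by positivity)
      _ = M - 1 := by field_simp

/-- Both points are within one mesh width `2R/(M-1)` of the same node, so they differ by at most
`4R/(M-1)`, and this is at most `8R/M` once `M ≥ 2`. -/
theorem abs_sub_le_of_hat_ne_zero {b M : ℕ} {R : ℝ} (hR : 0 < R) (hM : 1 ≤ M) {y y' : Fin b → ℝ}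
    (hy : ∀ i, |y i| ≤ R) (hy' : ∀ i, |y' i| ≤ R) {k : Fin b → Fin M} (h : hat R k y ≠ 0)
    (h' : hat R k y' ≠ 0) (i : Fin b) : |y i - y' i| ≤ 8 * R / M := by
  have h1 := abs_lt.1 (abs_lt_one_of_nodal_ne_zero h i)
  have h2 := abs_lt.1 (abs_lt_one_of_nodal_ne_zero h' i)
  have h3 := abs_le.1 (hy i)
  have h4 := abs_le.1 (hy' i)
  have hMpos : (0 : ℝ) < M := by exact_mod_cast hM
  rw [le_div_iff₀ hMpos]
  have hb : |y i - y' i| ≤ 2 * R := by rw [abs_le]; constructor <;> linarith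
  have hab := abs_nonneg (y i - y' i)
  -- For `M = 1` there is no mesh; the trivial bound `2R` suffices.
  rcases hM.eq_or_lt with rfl | hM2
  · push_cast
    linarith
  · have hM2' : (2 : ℝ) ≤ M := by exact_mod_cast hM2
    have hs : ((M : ℝ) - 1) / (2 * R) * |y i - y' i| ≤ 2 := by
      rw [← abs_of_nonneg (show 0 ≤ ((M : ℝ) - 1) / (2 * R) by
        apply div_nonneg <;> linarith), ← abs_mul, abs_le]
      constructor <;> linarith
    rw [div_mul_eq_mul_div, div_le_iff₀ (by linarith)] at hs
    nlinarith

/-- Interpolation on the Kuhn triangulation, with values taken at points of the cells. -/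
theorem exists_interpolation {X : Type*} [Nonempty X] {b M : ℕ} {R : ℝ} (hR : 0 < R) (hM : 1 ≤ M)
    (α : X → Fin b → ℝ) (hα : ∀ x i, |α x i| ≤ R) :
    ∃ rep : (Fin b → Fin M) → X, ∀ (F : X → ℝ) (η : ℝ),
      (∀ x x', (∀ i, |α x i - α x' i| ≤ 8 * R / M) → |F x - F x'| ≤ η) →
      ∀ x, |F x - ∑ k, F (rep k) * hat R k (α x)| ≤ η := by
  classical
  -- The values `α x` need not fill the cube, so a node may not be attained. Any point whose image
  -- lies in the support of the hat serves instead; if there is none, the hat vanishes on all data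
  -- and the choice is irrelevant.
  have hrep : ∀ k : Fin b → Fin M, ∃ r : X, ∀ x, hat R k (α x) ≠ 0 →
      ∀ i, |α x i - α r i| ≤ 8 * R / M := by
    intro k
    by_cases h : ∃ r, hat R k (α r) ≠ 0
    · obtain ⟨r, hr⟩ := h
      exact ⟨r, fun x hx => abs_sub_le_of_hat_ne_zero hR hM (hα x) (hα r) hx hr⟩
    · exact ⟨Classical.arbitrary X, fun x hx => absurd ⟨x, hx⟩ h⟩
  choose rep hrep using hrep
  refine ⟨rep, fun F η hF x => ?_⟩
  have h1 : F x - ∑ k, F (rep k) * hat R k (α x) = ∑ k, (F x - F (rep k)) * hat R k (α x) := by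
    simp only [sub_mul, Finset.sum_sub_distrib]
    rw [← Finset.mul_sum, sum_hat_eq_one hR hM (hα x), mul_one]
  rw [h1]
  calc |∑ k, (F x - F (rep k)) * hat R k (α x)|
      ≤ ∑ k, |(F x - F (rep k)) * hat R k (α x)| := Finset.abs_sum_le_sum_abs _ _
    _ ≤ ∑ k, η * hat R k (α x) := by
        refine Finset.sum_le_sum fun k _ => ?_
        rw [abs_mul, abs_of_nonneg (hat_nonneg R k _)]
        by_cases hk : hat R k (α x) = 0
        · simp [hk]
        · exact mul_le_mul_of_nonneg_right (hF _ _ (hrep k x hk)) (hat_nonneg R k _)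
    _ = η := by rw [← Finset.mul_sum, sum_hat_eq_one hR hM (hα x), mul_one]

/-! ### Operations on networks -/

namespace ReLUNet

/-! ### Parameter bounds and counts. -/

theorem one_le_depth {d : ℕ} (φ : ReLUNet d) : 1 ≤ φ.depth := by
  cases φ <;> simp [depth]

theorem ParamsBounded.mono {κ κ' : ℝ} (h : κ ≤ κ') :
    ∀ {d : ℕ} {φ : ReLUNet d}, φ.ParamsBounded κ → φ.ParamsBounded κ'
  | _, output _ _, hφ => ⟨fun i j => (hφ.1 i j).trans h, fun i => (hφ.2 i).trans h⟩
  | _, hidden _ _ _ _, hφ => ⟨⟨fun i j => (hφ.1.1 i j).trans h, fun i => (hφ.1.2 i).trans h⟩,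
      ParamsBounded.mono h hφ.2⟩

theorem exists_layer_bound {m d : ℕ} (W : Matrix (Fin m) (Fin d) ℝ) (b : Fin m → ℝ) :
    ∃ κ : ℝ, 0 < κ ∧ (∀ i j, |W i j| ≤ κ) ∧ ∀ i, |b i| ≤ κ := by
  refine ⟨1 + ∑ i, ∑ j, |W i j| + ∑ i, |b i|, by positivity, fun i j => ?_, fun i => ?_⟩
  · have h1 := Finset.single_le_sum (f := fun j => |W i j|) (fun _ _ => abs_nonneg _)
      (Finset.mem_univ j)
    have h2 := Finset.single_le_sum (f := fun i => ∑ j, |W i j|)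
      (fun _ _ => Finset.sum_nonneg fun _ _ => abs_nonneg _) (Finset.mem_univ i)
    have h3 : 0 ≤ ∑ i, |b i| := Finset.sum_nonneg fun _ _ => abs_nonneg _
    linarith
  · have h1 := Finset.single_le_sum (f := fun i => |b i|) (fun _ _ => abs_nonneg _)
      (Finset.mem_univ i)
    have h2 : 0 ≤ ∑ i, ∑ j, |W i j| :=
      Finset.sum_nonneg fun _ _ => Finset.sum_nonneg fun _ _ => abs_nonneg _
    linarith

theorem exists_paramsBounded : ∀ {d : ℕ} (φ : ReLUNet d), ∃ κ : ℝ, 0 < κ ∧ φ.ParamsBounded κ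
  | _, output W b => exists_layer_bound W b
  | _, hidden _ W b rest => by
      obtain ⟨κ, hκ, h⟩ := exists_layer_bound W b
      obtain ⟨κ', hκ', h'⟩ := exists_paramsBounded rest
      refine ⟨max κ κ', lt_max_of_lt_left hκ, ⟨fun i j => (h.1 i j).trans (le_max_left _ _),
        fun i => (h.2 i).trans (le_max_left _ _)⟩, h'.mono (le_max_right _ _)⟩

theorem layerNonzeros_le {m d : ℕ} (W : Matrix (Fin m) (Fin d) ℝ) (b : Fin m → ℝ) :
    layerNonzeros W b ≤ m * (d + 1) := by
  have h1 := Finset.card_filter_le (Finset.univ : Finset (Fin m × Fin d))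
    (fun ij => W ij.1 ij.2 ≠ 0)
  have h2 := Finset.card_filter_le (Finset.univ : Finset (Fin m)) (fun i => b i ≠ 0)
  simp only [Finset.card_univ, Fintype.card_prod, Fintype.card_fin] at h1 h2
  unfold layerNonzeros
  rw [mul_add, mul_one]
  exact add_le_add h1 h2

/-- Only the first layer sees the input dimension, so `d` is multiplied by the width once, not by
its square. -/
theorem nonzeros_le {w : ℕ} : ∀ {d : ℕ} (φ : ReLUNet d), φ.width ≤ w →
    φ.nonzeros ≤ (w + 1) * (d + 1) + φ.depth * (w + 1) ^ 2
  | d, output W b, _ => by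
      have := layerNonzeros_le W b
      simp only [nonzeros, depth]
      nlinarith [Nat.zero_le (w * d), Nat.zero_le w, Nat.zero_le ((w + 1) ^ 2)]
  | d, hidden m W b rest, h => by
      have h1 := layerNonzeros_le W b
      have hm : m ≤ w := (le_max_left _ _).trans h
      have h2 := nonzeros_le rest ((le_max_right m rest.width).trans h)
      simp only [nonzeros, depth]
      have h3 : m * (d + 1) ≤ (w + 1) * (d + 1) := Nat.mul_le_mul_right _ (by omega)
      have h4 : (w + 1) * (m + 1) ≤ (w + 1) ^ 2 := by
        rw [sq]; exact Nat.mul_le_mul_left _ (by omega)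
      rw [add_mul, one_mul]
      linarith

theorem exists_eq_hidden {d L : ℕ} (φ : ReLUNet d) (h : φ.depth = L + 2) :
    ∃ (m : ℕ) (W : Matrix (Fin m) (Fin d) ℝ) (b : Fin m → ℝ) (rest : ReLUNet m),
      φ = hidden m W b rest ∧ rest.depth = L + 1 := by
  cases φ with
  | output W b => simp [depth] at h
  | hidden m W b rest => exact ⟨m, W, b, rest, rfl, by simpa [depth] using h⟩

theorem exists_eq_output {d : ℕ} (φ : ReLUNet d) (h : φ.depth = 1) :
    ∃ (W : Matrix (Fin 1) (Fin d) ℝ) (b : Fin 1 → ℝ), φ = output W b := by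
  cases φ with
  | output W b => exact ⟨W, b, rfl⟩
  | hidden m W b rest => have := rest.one_le_depth; simp [depth] at h; omega

/-- Networks of the same depth run in parallel, each one on its own part of the input. -/
theorem exists_sum {J : Type} [Fintype J] {κ κ' β : ℝ} {c : J → ℝ}
    (hκ : 0 ≤ κ) (hκκ' : κ ≤ κ') (hκ' : Fintype.card J * (β * κ) ≤ κ') (hc : ∀ j, |c j| ≤ β)
    {w : ℕ} (L : ℕ) : ∀ {n : ℕ} {d : J → ℕ} (φ : ∀ j, ReLUNet (d j)) (σ : ∀ j, Fin (d j) → Fin n),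
      (∀ j, Function.Injective (σ j)) → (∀ j, (φ j).depth = L + 1) → (∀ j, (φ j).width ≤ w) →
      (∀ j, (φ j).ParamsBounded κ) →
      ∃ ψ : ReLUNet n, (∀ x, ψ.eval x = ∑ j, c j * (φ j).eval (x ∘ σ j)) ∧ ψ.depth = L + 1 ∧
        ψ.width ≤ Fintype.card J * w ∧ ψ.ParamsBounded κ' := by
  induction L with
  | zero =>
    intro n d φ σ hσ hd hw hp
    choose W b hφ using fun j => exists_eq_output (φ j) (hd j)
    -- The output layers are added with the coefficients `c`. The ranges of the `σ j` may overlap,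
    -- so one entry can collect a contribution from every `j`; hence the factor `card J * β`.
    have hsum : ∀ f : J → ℝ, (∀ j, |f j| ≤ κ) → |∑ j, c j * f j| ≤ κ' := fun f hf => by
      refine le_trans ((Finset.abs_sum_le_sum_abs _ _).trans ?_) hκ'
      calc ∑ j, |c j * f j| ≤ ∑ _j : J, β * κ := by
            refine Finset.sum_le_sum fun j _ => ?_
            rw [abs_mul]
            exact mul_le_mul (hc j) (hf j) (abs_nonneg _) ((abs_nonneg _).trans (hc j))
        _ = _ := by simp
    have hp' : ∀ j, (∀ i l, |W j i l| ≤ κ) ∧ ∀ i, |b j i| ≤ κ := fun j => by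
      have := hp j
      rwa [hφ j] at this
    refine ⟨output (fun i l => ∑ j, c j * Function.extend (σ j) (W j i) 0 l)
      (fun i => ∑ j, c j * b j i), fun x => ?_, rfl, Nat.zero_le _, fun i l => ?_, fun i => ?_⟩
    · simp only [hφ, eval, Matrix.mulVec, dotProduct, Pi.add_apply, mul_add,
        Finset.sum_add_distrib, Finset.sum_mul, Function.comp_apply]
      rw [Finset.sum_comm]
      congr 1
      refine Finset.sum_congr rfl fun j _ => ?_
      simp only [mul_assoc]
      rw [← Finset.mul_sum, sum_extend_mul (hσ j)]
    · exact hsum _ fun j => abs_extend_le (hσ j) hκ (fun l => (hp' j).1 i l) l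
    · exact hsum _ fun j => (hp' j).2 i
  | succ L ih =>
    intro n d φ σ hσ hd hw hp
    choose m W b rest hφ hrest using fun j => exists_eq_hidden (φ j) (hd j)
    have hp' : ∀ j, ((∀ i l, |W j i l| ≤ κ) ∧ ∀ i, |b j i| ≤ κ) ∧ (rest j).ParamsBounded κ :=
      fun j => by
        have := hp j
        rwa [hφ j] at this
    have hw' : ∀ j, m j ≤ w ∧ (rest j).width ≤ w := fun j => by
      have := hw j
      rw [hφ j] at this
      exact ⟨(le_max_left _ _).trans this, (le_max_right _ _).trans this⟩
    classical
    -- The new layer is the disjoint union of the first layers. From there on, network `j` reads its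
    -- own block, which is why the induction allows arbitrary injections `σ`.
    let ν := Fintype.equivFin (Σ j, Fin (m j))
    obtain ⟨ψ, hψ, hψd, hψw, hψp⟩ := ih rest (fun j i => ν ⟨j, i⟩)
      (fun j i i' h => by simpa using ν.injective h)
      hrest (fun j => (hw' j).2) (fun j => (hp' j).2)
    refine ⟨hidden _ (fun i l => Function.extend (σ (ν.symm i).1)
        (W (ν.symm i).1 (ν.symm i).2) 0 l)
      (fun i => b (ν.symm i).1 (ν.symm i).2) ψ, fun x => ?_, by simp [depth, hψd], ?_,
      ⟨fun i l => ?_, fun i => ?_⟩, hψp⟩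
    · simp only [eval, hψ, hφ]
      refine Finset.sum_congr rfl fun j _ => ?_
      congr 2
      funext i
      simp only [Function.comp_apply, Matrix.mulVec, dotProduct, Pi.add_apply]
      rw [sum_extend_mul (hσ _), Equiv.symm_apply_apply]
    · refine max_le ?_ hψw
      rw [Fintype.card_sigma]
      calc ∑ j, Fintype.card (Fin (m j)) ≤ ∑ _j : J, w :=
            Finset.sum_le_sum fun j _ => by simpa using (hw' j).1
        _ = _ := by simp
    · exact (abs_extend_le (hσ _) hκ (fun l => (hp' _).1.1 _ l) l).trans hκκ'
    · exact ((hp' _).1.2 _).trans hκκ'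

theorem abs_sum_mul_le {n : ℕ} {f g : Fin n → ℝ} {a b : ℝ} (ha : ∀ i, |f i| ≤ a)
    (hb : ∀ i, |g i| ≤ b) : |∑ i, f i * g i| ≤ n * (a * b) := by
  refine (Finset.abs_sum_le_sum_abs _ _).trans ?_
  calc ∑ i, |f i * g i| ≤ ∑ _i : Fin n, a * b := by
        refine Finset.sum_le_sum fun i _ => ?_
        rw [abs_mul]
        exact mul_le_mul (ha i) (hb i) (abs_nonneg _) ((abs_nonneg _).trans (ha i))
    _ = _ := by simp

/-- The affine map is merged into the first layer, so depth and width do not change. -/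
theorem exists_comp_affine {d n : ℕ} {κ B V κ' : ℝ} (φ : ReLUNet d) (hφ : φ.ParamsBounded κ)
    (A : Matrix (Fin d) (Fin n) ℝ) (v : Fin d → ℝ) (hA : ∀ i j, |A i j| ≤ B)
    (hv : ∀ i, |v i| ≤ V) (h1 : κ ≤ κ') (h2 : d * (κ * B) ≤ κ') (h3 : d * (κ * V) + κ ≤ κ') :
    ∃ ψ : ReLUNet n, (∀ x, ψ.eval x = φ.eval (A.mulVec x + v)) ∧ ψ.depth = φ.depth ∧
      ψ.width = φ.width ∧ ψ.ParamsBounded κ' := by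
  have key : ∀ {m : ℕ} (W : Matrix (Fin m) (Fin d) ℝ) (b : Fin m → ℝ) (x : Fin n → ℝ),
      (W * A).mulVec x + (W.mulVec v + b) = W.mulVec (A.mulVec x + v) + b := by
    intro m W b x
    rw [Matrix.mulVec_add, Matrix.mulVec_mulVec, add_assoc]
  have bd : ∀ {m : ℕ} (W : Matrix (Fin m) (Fin d) ℝ) (b : Fin m → ℝ),
      (∀ i j, |W i j| ≤ κ) → (∀ i, |b i| ≤ κ) →
      (∀ i j, |(W * A) i j| ≤ κ') ∧ ∀ i, |(W.mulVec v + b) i| ≤ κ' := by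
    intro m W b hW hb
    refine ⟨fun i j => ?_, fun i => ?_⟩
    · rw [Matrix.mul_apply]
      exact (abs_sum_mul_le (hW i) fun l => hA l j).trans h2
    · exact (abs_add_le _ _).trans ((add_le_add (abs_sum_mul_le (hW i) hv) (hb i)).trans h3)
  cases φ with
  | output W b =>
    exact ⟨output (W * A) (W.mulVec v + b), fun x => by simp only [eval, key], rfl, rfl,
      bd W b hφ.1 hφ.2⟩
  | hidden m W b rest =>
    exact ⟨hidden m (W * A) (W.mulVec v + b) rest, fun x => by simp only [eval, key], rfl, rfl,
      bd W b hφ.1.1 hφ.1.2, hφ.2.mono h1⟩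

/-- The coefficients `(1, 0)` apply a ReLU, and `(1, -1)` give the identity, which pads the depth.
-/
theorem exists_relu_comb (c : Fin 2 → ℝ) : ∀ {d : ℕ} (φ : ReLUNet d), ∃ ψ : ReLUNet d,
    (∀ x, ψ.eval x = c 0 * max (φ.eval x) 0 + c 1 * max (-φ.eval x) 0) ∧ ψ.depth = φ.depth + 1
  | d, output W b => by
      refine ⟨hidden 2 (fun i l => (![1, -1] : Fin 2 → ℝ) i * W 0 l)
        (fun i => (![1, -1] : Fin 2 → ℝ) i * b 0) (output (fun _ l => c l) 0), fun x => ?_, rfl⟩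
      simp [eval, Matrix.mulVec, dotProduct, Fin.sum_univ_two, add_comm]
  | d, hidden m W b rest => by
      obtain ⟨ψ, h, h'⟩ := exists_relu_comb c rest
      exact ⟨hidden m W b ψ, fun x => by simp only [eval, h], by simp [depth, h']⟩

theorem exists_deeper {d : ℕ} (φ : ReLUNet d) (k : ℕ) :
    ∃ ψ : ReLUNet d, (∀ x, ψ.eval x = φ.eval x) ∧ ψ.depth = φ.depth + k := by
  induction k with
  | zero => exact ⟨φ, fun _ => rfl, rfl⟩
  | succ k ih =>
    obtain ⟨ψ, h, h'⟩ := ih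
    obtain ⟨χ, hχ, hχ'⟩ := exists_relu_comb ![1, -1] ψ
    refine ⟨χ, fun x => ?_, by rw [hχ', h', add_assoc]⟩
    rw [hχ, ← h]
    simp only [Matrix.cons_val_zero, Matrix.cons_val_one]
    rcases le_total (ψ.eval x) 0 with h0 | h0
    · rw [max_eq_right h0, max_eq_left (by linarith)]; ring
    · rw [max_eq_left h0, max_eq_right (by linarith)]; ring

/-! ### Functions realized exactly. -/

/-- A function is realizable if some ReLU network realizes it. -/
def Realizable {d : ℕ} (f : (Fin d → ℝ) → ℝ) : Prop := ∃ φ : ReLUNet d, ∀ x, φ.eval x = f x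

theorem realizable_affine {d : ℕ} (w : Fin d → ℝ) (b : ℝ) :
    Realizable fun x : Fin d → ℝ => ∑ i, w i * x i + b :=
  ⟨output (fun _ => w) fun _ => b, fun _ => rfl⟩

theorem Realizable.relu {d : ℕ} {f : (Fin d → ℝ) → ℝ} (hf : Realizable f) :
    Realizable fun x => max (f x) 0 := by
  obtain ⟨φ, hφ⟩ := hf
  obtain ⟨ψ, hψ, -⟩ := exists_relu_comb ![1, 0] φ
  exact ⟨ψ, fun x => by simp [hψ, hφ]⟩

theorem Realizable.linearComb {d : ℕ} {f g : (Fin d → ℝ) → ℝ} (hf : Realizable f)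
    (hg : Realizable g) (a b : ℝ) : Realizable fun x => a * f x + b * g x := by
  obtain ⟨φ, hφ⟩ := hf
  obtain ⟨ψ, hψ⟩ := hg
  -- Both networks are padded to the common depth `φ.depth + ψ.depth - 1`.
  obtain ⟨φ', hφ', hdφ⟩ := exists_deeper φ (ψ.depth - 1)
  obtain ⟨ψ', hψ', hdψ⟩ := exists_deeper ψ (φ.depth - 1)
  obtain ⟨κ₁, hκ₁, hp₁⟩ := exists_paramsBounded φ'
  obtain ⟨κ₂, hκ₂, hp₂⟩ := exists_paramsBounded ψ'
  have h1 := φ.one_le_depth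
  have h2 := ψ.one_le_depth
  obtain ⟨χ, hχ, -⟩ := exists_sum (J := Fin 2) (κ := max κ₁ κ₂)
    (c := ![a, b]) (β := max |a| |b|)
    (le_max_of_le_left hκ₁.le) (le_max_left _ _) (le_max_right _ _)
    (by intro j; fin_cases j <;> simp) (w := max φ'.width ψ'.width) (φ.depth + ψ.depth - 2)
    (d := fun _ => d) ![φ', ψ'] (fun _ => id) (fun _ => Function.injective_id)
    (by intro j; fin_cases j <;> simp <;> omega) (by intro j; fin_cases j <;> simp)
    (by intro j; fin_cases j
        · exact hp₁.mono (le_max_left _ _)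
        · exact hp₂.mono (le_max_right _ _))
  exact ⟨χ, fun x => by simp [hχ, Fin.sum_univ_two, hφ', hψ', hφ, hψ]⟩

theorem Realizable.max {d : ℕ} {f g : (Fin d → ℝ) → ℝ} (hf : Realizable f) (hg : Realizable g) :
    Realizable fun x => max (f x) (g x) := by
  -- Here `max f g = max (f - g) 0 + g`.
  obtain ⟨φ, hφ⟩ := ((hf.linearComb hg 1 (-1)).relu).linearComb hg 1 1
  refine ⟨φ, fun x => ?_⟩
  rw [hφ]
  beta_reduce
  rcases le_total (f x) (g x) with h | h
  · rw [max_eq_right h, max_eq_right (by linarith)]; ring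
  · rw [max_eq_left h, max_eq_left (by linarith)]; ring

theorem realizable_fold_max {d : ℕ} (a : ℝ) (s : Finset (Fin d)) :
    Realizable fun z : Fin d → ℝ => s.fold Max.max 0 fun i => a * z i := by
  classical
  induction s using Finset.induction_on with
  | empty =>
    obtain ⟨φ, hφ⟩ := realizable_affine (0 : Fin d → ℝ) 0
    exact ⟨φ, fun x => by simp [hφ]⟩
  | insert i s hi ih =>
    obtain ⟨ψ, hψ⟩ := realizable_affine (Pi.single i a) 0
    obtain ⟨φ, hφ⟩ := Realizable.max ⟨ψ, hψ⟩ ih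
    refine ⟨φ, fun x => ?_⟩
    rw [hφ]
    beta_reduce
    rw [Finset.fold_insert hi]
    simp [Pi.single_apply]

theorem realizable_nodal (b : ℕ) : Realizable (nodal (b := b)) := by
  obtain ⟨ψ, hψ⟩ := realizable_affine (0 : Fin b → ℝ) 1
  obtain ⟨φ, hφ⟩ := ((Realizable.linearComb ⟨ψ, hψ⟩ ((realizable_fold_max 1 Finset.univ).linearComb
    (realizable_fold_max (-1) Finset.univ) 1 1) 1 (-1))).relu
  refine ⟨φ, fun x => ?_⟩
  rw [hφ, nodal]
  beta_reduce
  congr 1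
  simp
  ring

/-- Networks for the nodal basis functions after a linear map. -/
theorem exists_hat (b : ℕ) : ∃ (L w : ℕ) (κ : ℝ), 0 < κ ∧
    ∀ {M n : ℕ} {R B : ℝ} (A : Matrix (Fin b) (Fin n) ℝ), 1 ≤ M → 0 < R → 0 ≤ B →
      (∀ i j, |A i j| ≤ B) → ∀ k : Fin b → Fin M,
      ∃ ψ : ReLUNet n, (∀ x, ψ.eval x = hat R k (A.mulVec x)) ∧ ψ.depth = L + 1 ∧
        ψ.width ≤ w ∧ ψ.ParamsBounded (κ * M * (B / R + 1)) := by
  obtain ⟨φ, hφ⟩ := realizable_nodal b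
  obtain ⟨κ, hκ, hp⟩ := exists_paramsBounded φ
  refine ⟨φ.depth - 1, φ.width, κ * (1 + 2 * b), by positivity, ?_⟩
  intro M n R B A hM hR hB hA k
  have hM' : (1 : ℝ) ≤ M := by exact_mod_cast hM
  set s : ℝ := (M - 1) / (2 * R) with hs
  have hs0 : 0 ≤ s := div_nonneg (by linarith) (by linarith)
  have hsR : s * R = (M - 1) / 2 := by rw [hs]; field_simp
  have hsB : s * B ≤ M * (B / R) := by
    have : s ≤ M / R := by
      rw [hs, div_le_div_iff₀ (by linarith) hR]
      nlinarith
    calc s * B ≤ M / R * B := mul_le_mul_of_nonneg_right this hB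
      _ = _ := by ring
  have hq : 0 ≤ (M : ℝ) * (B / R) := by positivity
  have hb0 : (0 : ℝ) ≤ b := Nat.cast_nonneg b
  -- The argument of `nodal` is `k - s (A x + R)`, with matrix `-s A` and shift `k - s R`; the
  -- latter is at most `2M` in size because `s R = (M-1)/2`.
  obtain ⟨ψ, h1, h2, h3, h4⟩ := exists_comp_affine φ hp (-s • A) (fun i => (k i : ℕ) - s * R)
    (B := s * B) (V := 2 * M) (κ' := κ * (1 + 2 * b) * M * (B / R + 1))
    (fun i j => by
      rw [Matrix.smul_apply, smul_eq_mul, abs_mul, abs_neg, abs_of_nonneg hs0]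
      exact mul_le_mul_of_nonneg_left (hA i j) hs0)
    (fun i => by
      have h1 : ((k i : ℕ) : ℝ) ≤ M := by exact_mod_cast (k i).2.le
      have h0 : (0 : ℝ) ≤ (k i : ℕ) := Nat.cast_nonneg _
      rw [hsR, abs_le]
      constructor <;> linarith)
    (by
      have : κ * ((1 + 2 * b) * (M * (B / R) + M)) = κ * (1 + 2 * b) * M * (B / R + 1) := by ring
      rw [← this]
      refine le_mul_of_one_le_right hκ.le ?_
      nlinarith)
    (by
      have : κ * ((1 + 2 * b) * (M * (B / R) + M)) = κ * (1 + 2 * b) * M * (B / R + 1) := by ring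
      rw [← this, show (b : ℝ) * (κ * (s * B)) = κ * (b * (s * B)) by ring]
      refine mul_le_mul_of_nonneg_left ?_ hκ.le
      nlinarith [mul_le_mul_of_nonneg_left hsB hb0, mul_nonneg hb0 hq])
    (by
      have : κ * ((1 + 2 * b) * (M * (B / R) + M)) = κ * (1 + 2 * b) * M * (B / R + 1) := by ring
      rw [← this, show (b : ℝ) * (κ * (2 * M)) + κ = κ * (b * (2 * M) + 1) by ring]
      refine mul_le_mul_of_nonneg_left ?_ hκ.le
      nlinarith [mul_nonneg hb0 hq])
  refine ⟨ψ, fun x => ?_, ?_, h3.le, h4⟩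
  · rw [h1, hφ, hat]
    congr 1
    funext i
    simp only [Pi.add_apply, Matrix.smul_mulVec, Pi.smul_apply, smul_eq_mul]
    ring
  · rw [h2]
    have := φ.one_le_depth
    omega

end ReLUNet
/-! ### Coefficients with respect to an orthonormal family -/

theorem measurableSet_cube (d : ℕ) (γ : ℝ) : MeasurableSet (cube d γ) := by
  have h : cube d γ = ⋂ i, (fun x : EuclideanSpace ℝ (Fin d) => x i) ⁻¹' Set.Icc (-γ) γ := by
    ext x
    simp [cube]
  rw [h]
  exact MeasurableSet.iInter fun i =>
    measurableSet_Icc.preimage (by fun_prop : Measurable fun x : EuclideanSpace ℝ (Fin d) => x i)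

theorem norm_le_sum_abs {d : ℕ} (x : EuclideanSpace ℝ (Fin d)) : ‖x‖ ≤ ∑ i, |x i| := by
  rw [EuclideanSpace.norm_eq]
  refine Real.sqrt_le_iff.2 ⟨Finset.sum_nonneg fun _ _ => abs_nonneg _, ?_⟩
  simpa using Finset.sum_sq_le_sq_sum_of_nonneg (s := Finset.univ) (f := fun i => |x i|)
    fun _ _ => abs_nonneg _

instance isFiniteMeasure_cubeMeasure (d : ℕ) (γ : ℝ) : IsFiniteMeasure (cubeMeasure d γ) := by
  refine ⟨?_⟩
  rw [cubeMeasure, (MeasurableEmbedding.subtype_coe (measurableSet_cube d γ)).comap_apply]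
  refine lt_of_le_of_lt (measure_mono (t := Metric.closedBall 0 (d * γ)) ?_)
    measure_closedBall_lt_top
  rintro _ ⟨x, -, rfl⟩
  rw [mem_closedBall_zero_iff]
  refine (norm_le_sum_abs _).trans ?_
  calc ∑ i, |(x : EuclideanSpace ℝ (Fin d)) i| ≤ ∑ _i : Fin d, γ :=
        Finset.sum_le_sum fun i _ => abs_le.2 (x.2 i)
    _ = d * γ := by simp

/-- Integrate `|u ω| ≤ (β² + ω²)/2`. The bound does not depend on the family `ω`. -/
theorem abs_coeff_le {d b : ℕ} {γ β : ℝ} {ω : Fin b → cube d γ → ℝ}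
    (hω : IsOrthonormalFamily ω) {u : cube d γ → ℝ} (hu : ∀ x, |u x| ≤ β) (k : Fin b) :
    |coeff ω u k| ≤ (β ^ 2 * (cubeMeasure d γ).real Set.univ + 1) / 2 := by
  have hint : Integrable (fun x => ω k x * ω k x) (cubeMeasure d γ) :=
    (hω.1 k).integrable_mul (hω.1 k)
  have h := norm_integral_le_of_norm_le (μ := cubeMeasure d γ) (f := fun x => u x * ω k x)
    (g := fun x => (β ^ 2 + ω k x * ω k x) / 2) (((integrable_const _).add hint).div_const 2)
    (Filter.Eventually.of_forall fun x => by
      have h1 := hu x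
      rw [Real.norm_eq_abs, abs_mul]
      have h2 : |u x| ^ 2 ≤ β ^ 2 := pow_le_pow_left₀ (abs_nonneg _) h1 2
      nlinarith [sq_nonneg (|u x| - |ω k x|), abs_mul_abs_self (ω k x)])
  rw [Real.norm_eq_abs] at h
  refine h.trans (le_of_eq ?_)
  rw [integral_div, integral_add (integrable_const _) hint, hω.2 k k]
  simp [mul_comm]

/-- By Parseval the `L²` distance is the `ℓ²` distance of the coefficient vectors, which is at most
their `ℓ¹` distance. -/
theorem l2norm_sub_le {d b : ℕ} {γ δ : ℝ} {ω : Fin b → cube d γ → ℝ}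
    (hω : IsOrthonormalFamily ω) {U : Set (cube d γ → ℝ)} (hU : LiesInSpan U ω)
    {u₁ u₂ : cube d γ → ℝ} (h₁ : u₁ ∈ U) (h₂ : u₂ ∈ U) (hδ : 0 ≤ δ)
    (h : ∀ k, |coeff ω u₁ k - coeff ω u₂ k| ≤ δ) : l2norm (u₁ - u₂) ≤ b * δ := by
  set a : Fin b → ℝ := fun k => coeff ω u₁ k - coeff ω u₂ k with ha
  have hint : ∀ j k, Integrable (fun x => a j * a k * (ω j x * ω k x)) (cubeMeasure d γ) :=
    fun j k => ((hω.1 j).integrable_mul (hω.1 k)).const_mul _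
  have hae : (fun x => ((u₁ - u₂) x) ^ 2) =ᵐ[cubeMeasure d γ]
      fun x => ∑ j, ∑ k, a j * a k * (ω j x * ω k x) := by
    filter_upwards [hU u₁ h₁, hU u₂ h₂] with x hx₁ hx₂
    rw [Pi.sub_apply, hx₁, hx₂, ← Finset.sum_sub_distrib, sq, Finset.sum_mul_sum]
    refine Finset.sum_congr rfl fun j _ => Finset.sum_congr rfl fun k _ => ?_
    simp only [ha]
    ring
  have hsum : ∫ x, ((u₁ - u₂) x) ^ 2 ∂(cubeMeasure d γ) = ∑ k, a k ^ 2 := by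
    rw [integral_congr_ae hae, integral_finsetSum _ fun j _ => integrable_finsetSum _
      fun k _ => hint j k]
    refine Finset.sum_congr rfl fun j _ => ?_
    rw [integral_finsetSum _ fun k _ => hint j k]
    simp only [integral_const_mul, hω.2]
    simp [sq]
  rw [l2norm, hsum]
  refine Real.sqrt_le_iff.2 ⟨by positivity, ?_⟩
  calc ∑ k, a k ^ 2 ≤ (∑ k, |a k|) ^ 2 := by
        simpa using Finset.sum_sq_le_sq_sum_of_nonneg (s := Finset.univ) (f := fun i => |a i|)
          fun _ _ => abs_nonneg _
    _ ≤ (b * δ) ^ 2 := by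
        refine pow_le_pow_left₀ (Finset.sum_nonneg fun _ _ => abs_nonneg _) ?_ 2
        calc ∑ k, |a k| ≤ ∑ _k : Fin b, δ := Finset.sum_le_sum fun k _ => h k
          _ = _ := by simp

/-! ### Branch networks -/

/-- One hat network per node, run in parallel. The output bound `β` holds on all inputs since the
hats are nonnegative with sum at most one. -/
theorem exists_branch (b : ℕ) : ∃ (L w : ℕ) (κ : ℝ), 0 < κ ∧
    ∀ {M n : ℕ} {R B β : ℝ} (A : Matrix (Fin b) (Fin n) ℝ), 1 ≤ M → 0 < R → 0 ≤ B → 0 ≤ β →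
      (∀ i j, |A i j| ≤ B) → ∀ c : (Fin b → Fin M) → ℝ, (∀ k, |c k| ≤ β) →
      (fun x => ∑ k, c k * hat R k (A.mulVec x)) ∈
        networkClass n (L + 1) (M ^ b * w)
          ((M ^ b * w + 1) * (n + 1) + (L + 1) * (M ^ b * w + 1) ^ 2)
          ((1 + M ^ b * β) * (κ * M * (B / R + 1))) β := by
  obtain ⟨L, w, κ, hκ, H⟩ := ReLUNet.exists_hat b
  refine ⟨L, w, κ, hκ, ?_⟩
  intro M n R B β A hM hR hB hβ hA c hc
  choose φ hφ hd hw hp using H A hM hR hB hA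
  have hP : 0 ≤ κ * M * (B / R + 1) := by positivity
  have hcard : Fintype.card (Fin b → Fin M) = M ^ b := by simp
  have hMb : (0 : ℝ) ≤ (M : ℝ) ^ b := by positivity
  obtain ⟨ψ, hψ, hψd, hψw, hψp⟩ := ReLUNet.exists_sum (J := Fin b → Fin M) (c := c) (β := β)
    (κ := κ * M * (B / R + 1)) (κ' := (1 + M ^ b * β) * (κ * M * (B / R + 1))) hP
    (le_mul_of_one_le_left hP (by nlinarith [mul_nonneg hMb hβ]))
    (by rw [hcard]; push_cast; nlinarith) hc L φ (fun _ => id) (fun _ => Function.injective_id)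
    hd hw hp
  rw [hcard] at hψw
  refine ⟨⟨ψ, ?_, hψd, hψw, ?_, hψp⟩, fun x => ?_⟩
  · funext x
    rw [hψ]
    simp [hφ]
  · have := ReLUNet.nonzeros_le ψ hψw
    rwa [hψd] at this
  · calc |∑ k, c k * hat R k (A.mulVec x)| ≤ ∑ k, |c k * hat R k (A.mulVec x)| :=
          Finset.abs_sum_le_sum_abs _ _
      _ ≤ ∑ k : Fin b → Fin M, β * hat R k (A.mulVec x) := by
          refine Finset.sum_le_sum fun k _ => ?_
          rw [abs_mul, abs_of_nonneg (hat_nonneg R k _)]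
          exact mul_le_mul_of_nonneg_right (hc k) (hat_nonneg R k _)
      _ ≤ β := by
          rw [← Finset.mul_sum]
          exact mul_le_of_le_one_right hβ (sum_hat_le_one R _)

/-- Trunk networks. -/
theorem exists_trunk (d : ℕ) : ∃ (L w : ℕ) (κ : ℝ), 0 < κ ∧
    ∀ {M : ℕ} {R : ℝ}, 1 ≤ M → 0 < R → ∀ k : Fin d → Fin M,
      hat R k ∈ networkClass d (L + 1) w ((w + 1) * (d + 1) + (L + 1) * (w + 1) ^ 2)
        (κ * M * (1 / R + 1)) 1 := by
  obtain ⟨L, w, κ, hκ, H⟩ := ReLUNet.exists_hat d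
  refine ⟨L, w, κ, hκ, ?_⟩
  intro M R hM hR k
  obtain ⟨ψ, h, hd, hw, hp⟩ := H (1 : Matrix (Fin d) (Fin d) ℝ) hM hR zero_le_one
    (fun i j => by rw [Matrix.one_apply]; split_ifs <;> simp) k
  refine ⟨⟨ψ, ?_, hd, hw, ?_, hp⟩, fun x => ?_⟩
  · funext x
    rw [h, Matrix.one_mulVec]
  · have := ReLUNet.nonzeros_le ψ hw
    rwa [hd] at this
  · rw [abs_of_nonneg (hat_nonneg R k x)]
    exact hat_le_one R k x

/-! ### The approximation of an operator -/

theorem natCeil_le_mul {T e : ℝ} (hT : 0 ≤ T) (he : 0 < e) (he1 : e ≤ 1) :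
    ((⌈T / e⌉₊ : ℕ) : ℝ) ≤ (T + 1) * (1 / e) := by
  have h := (Nat.ceil_lt_add_one (div_nonneg hT he.le)).le
  have h1 : 1 ≤ 1 / e := by rw [le_div_iff₀ he]; linarith
  calc ((⌈T / e⌉₊ : ℕ) : ℝ) ≤ T / e + 1 := h
    _ = T * (1 / e) + 1 := by ring
    _ ≤ _ := by linarith

/-- This makes the trunk grid fit into the prescribed number of terms: either the grid has a single
node, or rounding up at most doubles `S / ε`. -/
theorem natCeil_pow_le {S ε : ℝ} (hS : 0 < S) (hε : 0 < ε) (d : ℕ) :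
    ⌈S / ε⌉₊ ^ d ≤ ⌈(2 * S) ^ d * (1 / ε) ^ d⌉₊ := by
  have hSε : 0 < S / ε := div_pos hS hε
  rcases le_or_gt (S / ε) 1 with h | h
  · have h1 : ⌈S / ε⌉₊ ≤ 1 := Nat.ceil_le.2 (by simpa using h)
    calc ⌈S / ε⌉₊ ^ d ≤ 1 ^ d := Nat.pow_le_pow_left h1 d
      _ = 1 := one_pow d
      _ ≤ _ := Nat.one_le_iff_ne_zero.2 (Nat.ceil_pos.2 (by positivity)).ne'
  · have h1 := (Nat.ceil_lt_add_one hSε.le).le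
    have h2 : ((⌈S / ε⌉₊ : ℕ) : ℝ) ≤ 2 * S * (1 / ε) := by
      have : 2 * S * (1 / ε) = S / ε + S / ε := by ring
      linarith
    have h3 : ((⌈S / ε⌉₊ ^ d : ℕ) : ℝ) ≤ (2 * S) ^ d * (1 / ε) ^ d := by
      push_cast
      rw [← mul_pow]
      exact pow_le_pow_left₀ (Nat.cast_nonneg _) h2 d
    exact_mod_cast h3.trans (Nat.le_ceil _)

theorem exists_representation {d₁ d₂ b n m M : ℕ} {γ₁ γ₂ βU βV LU LV LG R ε : ℝ}
    (hγ₂ : 0 < γ₂) (hβV : 0 < βV) (hLV : 0 < LV) (hLG : 0 < LG)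
    {U : Set (cube d₁ γ₁ → ℝ)} {V : Set (cube d₂ γ₂ → ℝ)} {ω : Fin b → cube d₁ γ₁ → ℝ}
    {x : Fin n → cube d₁ γ₁} {A : Matrix (Fin b) (Fin n) ℝ}
    (hU : IsLipschitzBoundedClass LU βU U) (hV : IsLipschitzBoundedClass LV βV V)
    (hω : IsOrthonormalFamily ω) (hspan : LiesInSpan U ω)
    (hA : ∀ u ∈ U, A.mulVec (samples x u) = coeff ω u)
    (hRdef : R = (βU ^ 2 * (cubeMeasure d₁ γ₁).real Set.univ + 1) / 2)
    (hm : 1 ≤ m) (hM : 1 ≤ M) (hmε : LV * (d₂ * (8 * γ₂ / m)) ≤ ε / 2)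
    (hMε : LG * (b * (8 * R / M)) ≤ ε / 2)
    (G : U → V) (hG : IsLipschitzOperator LG G) :
    ∃ c : (Fin d₂ → Fin m) → (Fin b → Fin M) → ℝ, (∀ k j, |c k j| ≤ βV) ∧
      ∀ (u : U) (y : cube d₂ γ₂),
        |(G u : cube d₂ γ₂ → ℝ) y - ∑ k, (∑ j, c k j * hat R j (A.mulVec (samples x u.1)))
          * hat γ₂ k (fun i => y.1 i)| ≤ ε := by
  rcases isEmpty_or_nonempty U with hE | hE
  · exact ⟨0, fun k j => by simpa using hβV.le, fun u => hE.elim u⟩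
  have hR : 0 < R := by rw [hRdef]; positivity
  have hE₂ : Nonempty (cube d₂ γ₂) := ⟨⟨0, fun i => by simp [hγ₂.le]⟩⟩
  obtain ⟨r, hr⟩ := exists_interpolation (M := M) hR hM (fun u : U => coeff ω u.1)
    fun u i => by rw [hRdef]; exact abs_coeff_le hω (hU u.1 u.2).2 i
  obtain ⟨s, hs⟩ := exists_interpolation (M := m) hγ₂ hm
    (fun (y : cube d₂ γ₂) i => y.1 i) fun y i => abs_le.2 (y.2 i)
  refine ⟨fun k j => (G (r j)).1 (s k), fun k j => (hV _ (G (r j)).2).2 _, fun u y => ?_⟩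
  rw [hA u.1 u.2]
  have h1 : |(G u).1 y - ∑ k, (G u).1 (s k) * hat γ₂ k (fun i => y.1 i)| ≤ ε / 2 := by
    refine hs (G u).1 (ε / 2) (fun y y' hy => ?_) y
    refine (((hV _ (G u).2).1 y y').trans ?_).trans hmε
    refine mul_le_mul_of_nonneg_left ?_ hLV.le
    rw [Subtype.dist_eq, dist_eq_norm]
    refine (norm_le_sum_abs _).trans ?_
    calc ∑ i, |(y.1 - y'.1) i| ≤ ∑ _i : Fin d₂, 8 * γ₂ / m := Finset.sum_le_sum fun i _ => hy i
      _ = _ := by simp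
  -- Branch `k` interpolates the scalar function `u ↦ G u (s k)`; the representatives `r` do not
  -- depend on `k`.
  have h2 : ∀ k, |(G u).1 (s k) - ∑ j, (G (r j)).1 (s k) * hat R j (coeff ω u.1)| ≤ ε / 2 := by
    intro k
    refine hr (fun u => (G u).1 (s k)) (ε / 2) (fun u u' h => ?_) u
    refine ((hG u u' (s k)).trans ?_).trans hMε
    exact mul_le_mul_of_nonneg_left
      (l2norm_sub_le hω hspan u.2 u'.2 (by positivity) h) hLG.le
  have hy : ∀ i, |y.1 i| ≤ γ₂ := fun i => abs_le.2 (y.2 i)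
  have h3 : |∑ k, ((G u).1 (s k) - ∑ j, (G (r j)).1 (s k) * hat R j (coeff ω u.1))
      * hat γ₂ k (fun i => y.1 i)| ≤ ε / 2 := by
    calc _ ≤ ∑ k, |((G u).1 (s k) - ∑ j, (G (r j)).1 (s k) * hat R j (coeff ω u.1))
          * hat γ₂ k (fun i => y.1 i)| := Finset.abs_sum_le_sum_abs _ _
      _ ≤ ∑ k : Fin d₂ → Fin m, ε / 2 * hat γ₂ k (fun i => y.1 i) := by
          refine Finset.sum_le_sum fun k _ => ?_
          rw [abs_mul, abs_of_nonneg (hat_nonneg _ k _)]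
          exact mul_le_mul_of_nonneg_right (h2 k) (hat_nonneg _ k _)
      _ = ε / 2 := by rw [← Finset.mul_sum, sum_hat_eq_one hγ₂ hm hy, mul_one]
  have h4 := abs_add_le ((G u).1 y - ∑ k, (G u).1 (s k) * hat γ₂ k (fun i => y.1 i))
    (∑ k, ((G u).1 (s k) - ∑ j, (G (r j)).1 (s k) * hat R j (coeff ω u.1))
      * hat γ₂ k (fun i => y.1 i))
  simp only [sub_mul, Finset.sum_sub_distrib, sub_add_sub_cancel] at h3 h4
  linarith

/-- A sum over a finite type, padded to a sum over `Fin N`. -/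
theorem exists_padding {J : Type} [Fintype J] [Nonempty J] {N : ℕ} (h : Fintype.card J ≤ N) :
    ∃ (g : Fin N → J) (t : Fin N → ℝ), (∀ k, t k = 0 ∨ t k = 1) ∧
      ∀ F : J → ℝ, ∑ k, t k * F (g k) = ∑ j, F j := by
  classical
  let ι : J → Fin N := fun j => Fin.castLE h (Fintype.equivFin J j)
  have hι : Function.Injective ι :=
    (Fin.castLE_injective h).comp (Fintype.equivFin J).injective
  refine ⟨Function.invFun ι, Function.extend ι 1 0, fun k => ?_, fun F => ?_⟩
  · by_cases hk : ∃ j, ι j = k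
    · obtain ⟨j, rfl⟩ := hk
      exact Or.inr (by rw [hι.extend_apply]; rfl)
    · exact Or.inl (by rw [Function.extend_apply' _ _ _ hk]; rfl)
  · rw [sum_extend_mul hι]
    simp [Function.leftInverse_invFun hι _]

end DeepONet

end

/-! ### Choice of the meshes and the final count. -/

theorem theorem3 (d₂ : ℕ) (hd₂ : 0 < d₂) (γ₂ LV : ℝ) (hγ₂ : 0 < γ₂) (hLV : 0 < LV) :
    -- `C` depends on `d₂, γ₂, LV` only
    ∃ C : ℝ, 0 < C ∧
      ∀ (d₁ bU : ℕ) (γ₁ βU βV LU LG CA : ℝ), 0 < d₁ → 0 < bU → 0 < γ₁ → 0 < βU → 0 < βV →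
        0 < LU → 0 < LG → 0 < CA →
      -- `c` is the constant hidden in all the `O`-bounds
      ∃ c : ℝ, 0 < c ∧
        ∀ (nx : ℕ) (U : Set (DeepONet.cube d₁ γ₁ → ℝ)) (V : Set (DeepONet.cube d₂ γ₂ → ℝ))
          (ω : Fin bU → DeepONet.cube d₁ γ₁ → ℝ) (x : Fin nx → DeepONet.cube d₁ γ₁)
          (A : Matrix (Fin bU) (Fin nx) ℝ),
          0 < nx →
          DeepONet.IsLipschitzBoundedClass LU βU U →
          DeepONet.IsLipschitzBoundedClass LV βV V →
          DeepONet.IsOrthonormalFamily ω →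
          DeepONet.LiesInSpan U ω →
          (∀ u ∈ U, A.mulVec (DeepONet.samples x u) = DeepONet.coeff ω u) →
          (∀ k j, |A k j| ≤ CA) →
        ∀ ε e : ℝ, 0 < ε → e = min ε (1 / 2) →
          ∃ (N L₁ p₁ K₁ L₂ p₂ K₂ : ℕ) (κ₁ κ₂ : ℝ),
            N = ⌈C * (1 / ε) ^ d₂⌉₊ ∧
            (L₁ : ℝ) ≤ c * Real.log (1 / e) ∧
            (p₁ : ℝ) ≤ c ∧
            (K₁ : ℝ) ≤ c * Real.log (1 / e) ∧
            κ₁ ≤ c * (1 / e) ∧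
            (L₂ : ℝ) ≤ c * Real.log (1 / e) ∧
            (p₂ : ℝ) ≤ c * (1 / e) ^ ((d₂ + 1) * bU) ∧
            (K₂ : ℝ) ≤ c * ((1 / e) ^ ((d₂ + 1) * bU) * (Real.log (1 / e) + nx)) ∧
            κ₂ ≤ c * (1 / e) ^ ((d₂ + 1) * (bU + 1)) ∧
            -- the total number of nonzero parameters
            (N : ℝ) * (K₁ + K₂) ≤
              c * ((1 / e) ^ ((d₂ + 1) * bU + d₂) * (Real.log (1 / e) + nx)) ∧
            ∀ G : U → V, DeepONet.IsLipschitzOperator LG G →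
              ∃ (q : Fin N → (Fin d₂ → ℝ) → ℝ) (a : Fin N → (Fin nx → ℝ) → ℝ),
                (∀ k, q k ∈ DeepONet.networkClass d₂ L₁ p₁ K₁ κ₁ 1) ∧
                (∀ k, a k ∈ DeepONet.networkClass nx L₂ p₂ K₂ κ₂ βV) ∧
                ∀ (u : U) (y : DeepONet.cube d₂ γ₂),
                  |(G u : DeepONet.cube d₂ γ₂ → ℝ) y
                    - ∑ k, a k (DeepONet.samples x (u : DeepONet.cube d₁ γ₁ → ℝ))
                        * q k (fun i => (y : EuclideanSpace ℝ (Fin d₂)) i)| ≤ ε := by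
  classical
  obtain ⟨Lt, wt, κt, hκt, Ht⟩ := DeepONet.exists_trunk d₂
  -- With `m ≥ S / ε` the interpolation error in `y`, `LV * d₂ * 8γ₂ / m`, is at most `ε / 2`; `T`
  -- below plays the same role for the coefficients.
  set S : ℝ := 16 * γ₂ * LV * d₂ with hS
  have hd₂' : (0 : ℝ) < d₂ := by exact_mod_cast hd₂
  have hSpos : 0 < S := by positivity
  clear_value S
  refine ⟨(2 * S) ^ d₂, by positivity, ?_⟩
  intro d₁ bU γ₁ βU βV LU LG CA hd₁ hbU hγ₁ hβU hβV hLU hLG hCA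
  obtain ⟨Lb, wb, κb, hκb, Hb⟩ := DeepONet.exists_branch bU
  set R : ℝ := (βU ^ 2 * (DeepONet.cubeMeasure d₁ γ₁).real Set.univ + 1) / 2 with hRdef
  have hR : 0 < R := by rw [hRdef]; positivity
  clear_value R
  have hbU' : (0 : ℝ) < bU := by exact_mod_cast hbU
  set T : ℝ := 16 * R * LG * bU with hT
  have hTpos : 0 < T := by positivity
  clear_value T
  set K₁ : ℕ := (wt + 1) * (d₂ + 1) + (Lt + 1) * (wt + 1) ^ 2 with hK₁
  set D : ℝ := (T + 1) ^ bU * wb + 1 with hD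
  have hDpos : 0 < D := by positivity
  clear_value D
  -- the constants in the individual bounds
  set cκ₁ : ℝ := κt * (S + 1) * (1 / γ₂ + 1) with hcκ₁
  set cK₂ : ℝ := 2 * D + (Lb + 1) * D ^ 2 with hcK₂
  set cκ₂ : ℝ := (1 + (T + 1) ^ bU * βV) * (κb * (T + 1) * (CA / R + 1)) with hcκ₂
  set cN : ℝ := ((2 * S) ^ d₂ + 1) * (2 * K₁ + cK₂) with hcN
  have hcκ₁0 : 0 < cκ₁ := by positivity
  have hcK₂0 : 0 < cK₂ := by positivity
  have hcκ₂0 : 0 < cκ₂ := by positivity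
  have hcN0 : 0 < cN := by positivity
  have hK₁0 : (0 : ℝ) ≤ K₁ := Nat.cast_nonneg _
  have hLt0 : (0 : ℝ) ≤ Lt := Nat.cast_nonneg _
  have hLb0 : (0 : ℝ) ≤ Lb := Nat.cast_nonneg _
  have hwt0 : (0 : ℝ) ≤ wt := Nat.cast_nonneg _
  clear_value K₁ cκ₁ cK₂ cκ₂ cN
  set c : ℝ := 2 * (Lt + 1) + wt + 2 * K₁ + cκ₁ + 2 * (Lb + 1) + D + cK₂ + cκ₂ + cN with hc
  refine ⟨c, by positivity, ?_⟩
  clear_value c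
  intro nx U V ω x A hnx hU hV hω hspan hA hCAA ε e hε he
  have he0 : 0 < e := by rw [he]; exact lt_min hε (by norm_num)
  have heε : e ≤ ε := by rw [he]; exact min_le_left _ _
  have he2 : e ≤ 1 / 2 := by rw [he]; exact min_le_right _ _
  set E : ℝ := 1 / e with hE
  have hE2 : 2 ≤ E := by rw [hE, le_div_iff₀ he0]; linarith
  have hE1 : 1 ≤ E := by linarith
  -- This lets a constant `a` be absorbed as `2 * a * Real.log E`.
  have hlog : 1 / 2 ≤ Real.log E := by
    have := Real.log_le_log (by norm_num) hE2
    linarith [Real.log_two_gt_d9]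
  have hnx1 : (1 : ℝ) ≤ nx := by exact_mod_cast hnx
  -- The trunk mesh uses `ε` itself, since `m ^ d₂` must not exceed an `N` defined through `ε`; the
  -- branch mesh may use the smaller `e`.
  set m : ℕ := ⌈S / ε⌉₊ with hm
  set M : ℕ := ⌈T / e⌉₊ with hMdef
  have hm1 : 1 ≤ m := Nat.ceil_pos.2 (div_pos hSpos hε)
  have hM1 : 1 ≤ M := Nat.ceil_pos.2 (div_pos hTpos he0)
  have hmR : (0 : ℝ) < m := by exact_mod_cast hm1
  have hMR : (0 : ℝ) < M := by exact_mod_cast hM1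
  have hmE : (m : ℝ) ≤ (S + 1) * E := by
    refine le_trans ?_ (DeepONet.natCeil_le_mul hSpos.le he0 (by linarith))
    have : m ≤ ⌈S / e⌉₊ := Nat.ceil_mono (div_le_div_of_nonneg_left hSpos.le he0 heε)
    exact_mod_cast this
  have hME : (M : ℝ) ≤ (T + 1) * E := DeepONet.natCeil_le_mul hTpos.le he0 (by linarith)
  have hMb : (M : ℝ) ^ bU ≤ (T + 1) ^ bU * E ^ bU := by
    rw [← mul_pow]
    exact pow_le_pow_left₀ hMR.le hME bU
  have hεE : 1 / ε ≤ E := one_div_le_one_div_of_le he0 heε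
  have hSm : S / ε ≤ m := Nat.le_ceil _
  have hTM : T / e ≤ M := Nat.le_ceil _
  have hmN : m ^ d₂ ≤ ⌈(2 * S) ^ d₂ * (1 / ε) ^ d₂⌉₊ := DeepONet.natCeil_pow_le hSpos hε d₂
  clear_value m M E
  have hEpow : ∀ {i j : ℕ}, i ≤ j → E ^ i ≤ E ^ j := fun h => pow_le_pow_right₀ hE1 h
  have hEpos : ∀ i : ℕ, 0 < E ^ i := fun i => by positivity
  have hEone : ∀ i : ℕ, 1 ≤ E ^ i := fun i => one_le_pow₀ hE1
  have hp₂ : ((M ^ bU * wb : ℕ) : ℝ) + 1 ≤ D * E ^ bU := by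
    push_cast
    have h1 := mul_le_mul_of_nonneg_right hMb (Nat.cast_nonneg (α := ℝ) wb)
    rw [hD, add_mul, one_mul, mul_right_comm]
    exact add_le_add h1 (hEone bU)
  have hexp₁ : bU ≤ (d₂ + 1) * bU := Nat.le_mul_of_pos_left _ (Nat.succ_pos _)
  -- This is where `d₂ ≥ 1` makes room for the square of the branch width.
  have hexp₂ : 2 * bU ≤ (d₂ + 1) * bU := Nat.mul_le_mul_right _ (by omega)
  have hexp₃ : bU + 1 ≤ (d₂ + 1) * (bU + 1) := Nat.le_mul_of_pos_left _ (Nat.succ_pos _)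
  have hl0 : 0 < Real.log E := by linarith only [hlog]
  have hK₂ : (((M ^ bU * wb + 1) * (nx + 1) + (Lb + 1) * (M ^ bU * wb + 1) ^ 2 : ℕ) : ℝ) ≤
      cK₂ * (E ^ ((d₂ + 1) * bU) * (Real.log E + nx)) := by
    set P : ℝ := ((M ^ bU * wb : ℕ) : ℝ) + 1 with hP
    have hP0 : 0 ≤ P := by positivity
    have e1 : (((M ^ bU * wb + 1) * (nx + 1) + (Lb + 1) * (M ^ bU * wb + 1) ^ 2 : ℕ) : ℝ) =
        P * (nx + 1) + (Lb + 1) * P ^ 2 := by rw [hP]; push_cast; ring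
    have hP1 : P ≤ D * E ^ ((d₂ + 1) * bU) :=
      hp₂.trans (mul_le_mul_of_nonneg_left (hEpow hexp₁) hDpos.le)
    have hP2 : P ^ 2 ≤ D ^ 2 * E ^ ((d₂ + 1) * bU) := by
      calc P ^ 2 ≤ (D * E ^ bU) ^ 2 := pow_le_pow_left₀ hP0 hp₂ 2
        _ = D ^ 2 * E ^ (2 * bU) := by rw [mul_pow, ← pow_mul, mul_comm bU 2]
        _ ≤ _ := mul_le_mul_of_nonneg_left (hEpow hexp₂) (by positivity)
    set Q := E ^ ((d₂ + 1) * bU) with hQ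
    have hQ0 : 0 < Q := hEpos _
    rw [e1]
    have f1 : P * (nx + 1) ≤ D * Q * (2 * (Real.log E + nx)) :=
      mul_le_mul hP1 (by linarith) (by positivity) (by positivity)
    have f2 : (Lb + 1) * P ^ 2 ≤ (Lb + 1) * (D ^ 2 * Q * (Real.log E + nx)) := by
      refine mul_le_mul_of_nonneg_left (hP2.trans ?_) (by positivity)
      exact le_mul_of_one_le_right (by positivity) (by linarith)
    calc _ ≤ D * Q * (2 * (Real.log E + nx)) + (Lb + 1) * (D ^ 2 * Q * (Real.log E + nx)) :=
          add_le_add f1 f2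
      _ = _ := by rw [hcK₂]; ring
  have hN : ((⌈(2 * S) ^ d₂ * (1 / ε) ^ d₂⌉₊ : ℕ) : ℝ) ≤ ((2 * S) ^ d₂ + 1) * E ^ d₂ := by
    have h1 := (Nat.ceil_lt_add_one (show 0 ≤ (2 * S) ^ d₂ * (1 / ε) ^ d₂ by positivity)).le
    have h2 : (1 / ε) ^ d₂ ≤ E ^ d₂ :=
      pow_le_pow_left₀ (by positivity) hεE d₂
    have h3 := mul_le_mul_of_nonneg_left h2 (show 0 ≤ (2 * S) ^ d₂ by positivity)
    linarith [hEone d₂]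
  have hmul : ∀ {a g : ℝ}, a ≤ c → 0 ≤ g → a * g ≤ c * g := fun h hg =>
    mul_le_mul_of_nonneg_right h hg
  have hlog' : ∀ a : ℝ, 0 ≤ a → a ≤ 2 * a * Real.log E := fun a ha => by
    nlinarith only [ha, hlog]
  refine ⟨⌈(2 * S) ^ d₂ * (1 / ε) ^ d₂⌉₊, Lt + 1, wt, K₁, Lb + 1, M ^ bU * wb,
    (M ^ bU * wb + 1) * (nx + 1) + (Lb + 1) * (M ^ bU * wb + 1) ^ 2,
    κt * m * (1 / γ₂ + 1), (1 + M ^ bU * βV) * (κb * M * (CA / R + 1)), rfl,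
    ?_, ?_, ?_, ?_, ?_, ?_, ?_, ?_, ?_, ?_⟩
  · push_cast
    exact (hlog' _ (by positivity)).trans (hmul (by rw [hc]; linarith) hl0.le)
  · rw [hc]; linarith
  · exact (hlog' _ hK₁0).trans (hmul (by rw [hc]; linarith) hl0.le)
  · refine le_trans ?_ (hmul (a := cκ₁) (by rw [hc]; linarith) (by linarith))
    have := mul_le_mul_of_nonneg_left hmE (show 0 ≤ κt * (1 / γ₂ + 1) by positivity)
    rw [hcκ₁]
    linarith
  · push_cast
    exact (hlog' _ (by positivity)).trans (hmul (by rw [hc]; linarith) hl0.le)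
  · refine le_trans ?_ (hmul (a := D) (by rw [hc]; linarith) (hEpos _).le)
    exact le_trans (by linarith) (mul_le_mul_of_nonneg_left (hEpow hexp₁) hDpos.le)
  · exact hK₂.trans (hmul (by rw [hc]; linarith) (mul_nonneg (hEpos _).le (by linarith)))
  · refine le_trans ?_ (hmul (a := cκ₂) (by rw [hc]; linarith) (hEpos _).le)
    refine le_trans ?_ (mul_le_mul_of_nonneg_left (hEpow hexp₃) hcκ₂0.le)
    have f1 : 1 + (M : ℝ) ^ bU * βV ≤ (1 + (T + 1) ^ bU * βV) * E ^ bU := by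
      have := mul_le_mul_of_nonneg_right hMb hβV.le
      linarith [hEone bU]
    have f2 : κb * M * (CA / R + 1) ≤ κb * (T + 1) * (CA / R + 1) * E := by
      have := mul_le_mul_of_nonneg_left hME (show 0 ≤ κb * (CA / R + 1) by positivity)
      linarith
    calc _ ≤ (1 + (T + 1) ^ bU * βV) * E ^ bU * (κb * (T + 1) * (CA / R + 1) * E) :=
          mul_le_mul f1 f2 (by positivity) (by positivity)
      _ = _ := by rw [hcκ₂, pow_succ]; ring
  · refine le_trans ?_ (hmul (a := cN) (by rw [hc]; linarith)
      (mul_nonneg (hEpos _).le (by linarith)))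
    have f1 : (K₁ : ℝ) ≤ 2 * K₁ * (E ^ ((d₂ + 1) * bU) * (Real.log E + nx)) := by
      have : 1 ≤ E ^ ((d₂ + 1) * bU) * (Real.log E + nx) :=
        one_le_mul_of_one_le_of_one_le (hEone _) (by linarith)
      nlinarith only [this, hK₁0]
    calc _ ≤ ((2 * S) ^ d₂ + 1) * E ^ d₂ *
          ((2 * K₁ + cK₂) * (E ^ ((d₂ + 1) * bU) * (Real.log E + nx))) :=
          mul_le_mul hN (by linarith) (by positivity) (by positivity)
      _ = _ := by rw [hcN, pow_add]; ring
  · intro G hG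
    have hmε : LV * (d₂ * (8 * γ₂ / m)) ≤ ε / 2 := by
      rw [div_le_iff₀ hε] at hSm
      rw [show LV * (d₂ * (8 * γ₂ / m)) = S / 2 / m by rw [hS]; ring, div_le_iff₀ hmR]
      linarith
    have hMε : LG * (bU * (8 * R / M)) ≤ ε / 2 := by
      rw [div_le_iff₀ he0] at hTM
      rw [show LG * (bU * (8 * R / M)) = T / 2 / M by rw [hT]; ring, div_le_iff₀ hMR]
      nlinarith only [hTM, heε, hMR]
    obtain ⟨co, hco, happ⟩ := DeepONet.exists_representation hγ₂ hβV hLV hLG hU hV hω hspan hA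
      hRdef hm1 hM1 hmε hMε G hG
    have : Nonempty (Fin d₂ → Fin m) := ⟨fun _ => ⟨0, hm1⟩⟩
    obtain ⟨g, t, ht, hgt⟩ := DeepONet.exists_padding (J := Fin d₂ → Fin m)
      (N := ⌈(2 * S) ^ d₂ * (1 / ε) ^ d₂⌉₊) (by simpa using hmN)
    refine ⟨fun k => DeepONet.hat γ₂ (g k),
      fun k z => ∑ j, t k * co (g k) j * DeepONet.hat R j (A.mulVec z),
      fun k => Ht hm1 hγ₂ (g k), fun k => ?_, fun u y => ?_⟩
    -- The padding factors `t k` are 0 or 1, so they go into the branch coefficients without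
    -- breaking the bound `βV`.
    · refine Hb A hM1 hR hCA.le hβV.le hCAA (fun j => t k * co (g k) j) fun j => ?_
      rcases ht k with h | h <;> rw [h]
      · simpa using hβV.le
      · simpa using hco (g k) j
    · have := happ u y
      rw [← hgt] at this
      simpa only [mul_assoc, ← Finset.mul_sum] using this
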